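/- **Model.** An instance of online $b$-matching with reusable resources consists of a finite non-empty set $I$ of resources, where resource $i$ has $c_i\ge 1$ units $k=1,\dots,c_i$, a usage distribution $F_i$ on $[0,\infty]$ (duration $\infty$ means that the unit never returns), and a non-negative non-decreasing reward function $r_i(\cdot)$ with finite mean $r_i=\mathbb E_{d\sim F_i}[r_i(d)]$; and of arrivals $t=1,\dots,T$ at times $a(1)<\dots<a(T)$, where arrival $t$ has the set $S_t\subseteq I$ of neighbours. Let $c_{\min}=\min_i c_i$. An arrival can be matched, irrevocably and on arrival, to at most one available unit of a resource in $S_t$. If $t$ is matched to a unit of $i$, the unit is used for a duration $d_{it}\sim F_i$ (all durations are independent), the reward $r_i(d_{it})$ is earned, and the unit is available for arrivals at times $\ge a(t)+d_{it}$. **Benchmark.** $\mathrm{OPT}$ is the supremum of the expected total reward over all offline (clairvoyant) policies. Such a policy knows the whole instance, but observes a realized duration only when the unit returns: its decision on $t$ depends only on its earlier decisions and on the durations of the units that have returned by time $a(t)$. **The fluid algorithm GALG.** It maintains the available fraction $z_i(k)\in[0,1]$ of each unit, initially $1$, and outputs the fraction $y_i(k,t)$ of unit $k$ of $i$ matched to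 $t$. Returns are deterministic: exactly the fraction $F_i(d)$ of an amount matched at time $a(\tau)$ is available again by time $a(\tau)+d$. So just before arrival $t\ge 2$ is served, $z_i(k)$ is increased by $$\sum_{\tau=1}^{t-2}\big(F_i(a(t)-a(\tau))-F_i(a(t-1)-a(\tau))\big)\,y_i(k,\tau)+F_i(a(t)-a(t-1))\,y_i(k,t-1).$$ Then set $\eta=0$ and $y_i(k,t)=0$ and, while $\eta<1$, do the following. Let $k^*(i)$ be the largest $k\in\{1,\dots,c_i\}$ with $z_i(k)>0$ (and $k^*(i)=0$ if there is none). Choose $i^*\in S_t$ that maximizes the reduced price $r_i\,(1-e^{-k^*(i)/c_i})$, with ties broken arbitrarily. If $S_t=\emptyset$ or $k^*(i^*)=0$, stop. Otherwise let $y=\min\{z_{i^*}(k^*(i^*)),\,1-\eta\}$, increase $\eta$ and $y_{i^*}(k^*(i^*),t)$ by $y$, and decrease $z_{i^*}(k^*(i^*))$ by $y$. The total reward of the algorithm is $\mathrm{GALG}=\sum_{i}r_i\sum_{t=1}^{T}\sum_{k=1}^{c_i}y_i(k,t)$. **Statement.** There is an absolute constant $C\ge 0$ such that for every instance and every way of breaking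 ties, $$\mathrm{GALG}\;\ge\;\Big(1-\frac1e-\frac{C}{c_{\min}}\Big)\,\mathrm{OPT}.$$ -/

import Mathlib

open MeasureTheory
open scoped ENNReal

/-- An instance of online `b`-matching with reusable resources. `I` is the set of resources.
Usage durations take values in `[0, ∞]`; a duration `∞` means that the unit never returns. -/
structure RentalInstance (I : Type*) where
  /-- starting inventory `c i` of resource `i` -/
  cap : I → ℕ
  cap_pos : ∀ i, 0 < cap i
  /-- law of the usage durations of resource `i` -/
  law : I → Measure ℝ≥0∞
  isProb : ∀ i, IsProbabilityMeasure (law i)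
  /-- reward of a use of a unit of `i`, as a function of the duration of that use -/
  rew : I → ℝ≥0∞ → ℝ
  rew_nonneg : ∀ i d, 0 ≤ rew i d
  rew_mono : ∀ i, Monotone (rew i)
  rew_integrable : ∀ i, Integrable (rew i) (law i)
  /-- number of arrivals; the arrivals are `0, 1, …, T - 1` -/
  T : ℕ
  /-- arrival times (only the values at `t < T` matter) -/
  a : ℕ → ℝ
  a_strictMono : StrictMonoOn a (Set.Iio T)
  /-- the resources that have an edge to arrival `t` (only the values at `t < T` matter) -/
  nbr : ℕ → Finset I

namespace RentalInstance

attribute [instance] RentalInstance.isProb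

noncomputable section

variable {I : Type*} (P : RentalInstance I)

/-- The smallest starting inventory. -/
def cmin [Fintype I] [Nonempty I] : ℕ :=
  Finset.univ.inf' Finset.univ_nonempty P.cap

/-- The expected reward `r i` of one use of a unit of resource `i`. -/
def meanRew (i : I) : ℝ := ∫ d, P.rew i d ∂(P.law i)

/-- The cumulative distribution function `F i` at `d ≥ 0`. -/
def cdf (i : I) (d : ℝ) : ℝ := (P.law i).real (Set.Iic (ENNReal.ofReal d))

/-! ### The fluid algorithm -/

/-- The part of an allocation of resource `i` to arrival `τ` that has come back by the time at
which arrival `t` is served: the fraction `F i (a t - a τ)` if `τ < t`. For `t = τ` it is `0`,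
even if `F i 0 > 0`: at the time `a τ` nothing comes back before arrival `τ` has been served. -/
def returned (i : I) (τ t : ℕ) : ℝ := if τ < t then P.cdf i (P.a t - P.a τ) else 0

/-- The reduced price `r i * (1 - exp (-k / c i))` of unit `k` of resource `i`. -/
def price (i : I) (k : ℕ) : ℝ :=
  P.meanRew i * (1 - Real.exp (-((k : ℝ) / (P.cap i : ℝ))))

/-- The highest unit of `i` (units are numbered `1, …, c i`) of which a positive fraction is
available, and `0` if there is none. -/
def highest (z : I → ℕ → ℝ) (i : I) : ℕ :=
  ((Finset.Icc 1 (P.cap i)).filter (fun k => 0 < z i k)).sup id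

/-- `sel t κ` is the resource chosen for arrival `t` when `κ i` is the highest available unit of
each resource `i`: a neighbour of `t` of maximal reduced price, ties being broken arbitrarily. -/
def IsArgmaxRule (sel : ℕ → (I → ℕ) → I) : Prop :=
  ∀ t < P.T, (P.nbr t).Nonempty → ∀ κ : I → ℕ,
    sel t κ ∈ P.nbr t ∧ ∀ j ∈ P.nbr t, P.price j (κ j) ≤ P.price (sel t κ) (κ (sel t κ))

/-- The variables of the inner loop while one arrival is served: the fraction `eta` of the arrival
that has been matched, the available fractions `z i k` of the units, and the fractions `y i k` of
the units that have been matched to this arrival. -/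
structure LoopState (I : Type*) where
  eta : ℝ
  z : I → ℕ → ℝ
  y : I → ℕ → ℝ

/-- The inner loop performs another round. -/
def Continues (sel : ℕ → (I → ℕ) → I) (t : ℕ) (s : LoopState I) : Prop :=
  s.eta < 1 ∧ (P.nbr t).Nonempty ∧
    P.highest s.z (sel t (P.highest s.z)) ≠ 0

open Classical in
/-- One round of the inner loop, which leaves the state unchanged once the loop has ended. -/
def loopBody (sel : ℕ → (I → ℕ) → I) (t : ℕ) (s : LoopState I) : LoopState I :=
  if P.Continues sel t s then
    let i' := sel t (P.highest s.z)
    let k' := P.highest s.z i'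
    let amount := min (s.z i' k') (1 - s.eta)
    { eta := s.eta + amount
      z := fun i k => if i = i' ∧ k = k' then s.z i k - amount else s.z i k
      y := fun i k => if i = i' ∧ k = k' then s.y i k + amount else s.y i k }
  else s

/-- The inner loop for arrival `t`, started with available fractions `z`. After `∑ i, c i` rounds
it has ended, see `not_continues_loop`. -/
def loop [Fintype I] (sel : ℕ → (I → ℕ) → I) (t : ℕ) (z : I → ℕ → ℝ) : LoopState I :=
  (P.loopBody sel t)^[∑ i, P.cap i] { eta := 0, z := z, y := fun _ _ => 0 }

/-- The variables of the fluid algorithm: the available fractions `z i k`, and the fractions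
`y t i k` of unit `k` of resource `i` that have been matched to the arrivals `t`. -/
structure FluidState (I : Type*) where
  z : I → ℕ → ℝ
  y : ℕ → I → ℕ → ℝ

/-- The available fractions just before arrival `t` is matched: what came back since the previous
arrival is added. -/
def fluidUpdate (t : ℕ) (s : FluidState I) : I → ℕ → ℝ := fun i k =>
  s.z i k + ∑ τ ∈ Finset.range t, (P.returned i τ t - P.returned i τ (t - 1)) * s.y τ i k

/-- The state of the fluid algorithm after the first `n` arrivals have been served. -/
def fluidState [Fintype I] (sel : ℕ → (I → ℕ) → I) : ℕ → FluidState I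
  | 0 => { z := fun _ _ => 1, y := fun _ _ _ => 0 }
  | n + 1 =>
    let s := fluidState sel n
    let l := P.loop sel n (P.fluidUpdate n s)
    { z := l.z, y := Function.update s.y n l.y }

/-- The total fraction `x i t` of arrival `t` that the fluid algorithm matches to resource `i`. -/
def fluidMatch [Fintype I] (sel : ℕ → (I → ℕ) → I) (i : I) (t : ℕ) : ℝ :=
  ∑ k ∈ Finset.Icc 1 (P.cap i), (P.fluidState sel P.T).y t i k

/-- The total reward of the fluid algorithm. -/
def galg [Fintype I] (sel : ℕ → (I → ℕ) → I) : ℝ :=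
  ∑ i, P.meanRew i * ∑ t ∈ Finset.range P.T, P.fluidMatch sel i t

/-! ### The clairvoyant optimum -/

/-- A sample path: the duration `ω t i` for which a unit of `i` is used if it is matched to `t`. -/
abbrev SamplePath : Type _ := Fin P.T → I → ℝ≥0∞

/-- All durations are independent, and `ω t i` has the usage distribution of `i`. -/
def pathLaw [Fintype I] : Measure P.SamplePath :=
  Measure.pi (fun _ : Fin P.T => Measure.pi P.law)

/-- What is known about the duration `d` of a use when the time `h` has passed since its start:
the duration itself if the unit has come back, and nothing more than `d > h` otherwise. -/
def observed (h : ℝ) (d : ℝ≥0∞) : Option ℝ≥0∞ :=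
  if d ≤ ENNReal.ofReal h then some d else none

/-- An offline (clairvoyant) policy. It knows the whole instance, and observes a duration only when
the unit comes back. `dec t ω = some (i, k)` means that arrival `t` is matched to unit `k` of
resource `i`, and `dec t ω = none` that it is rejected. -/
structure OfflinePolicy where
  dec : Fin P.T → P.SamplePath → Option (I × ℕ)
  measurable_dec : ∀ t m, MeasurableSet {ω | dec t ω = m}
  edge : ∀ t ω i k, dec t ω = some (i, k) → i ∈ P.nbr t ∧ k ∈ Finset.Icc 1 (P.cap i)
  /-- a unit that is matched again has come back before -/
  available : ∀ τ t ω i k, τ < t → dec τ ω = some (i, k) → dec t ω = some (i, k) →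
    ω τ i ≤ ENNReal.ofReal (P.a t - P.a τ)
  /-- the decision on arrival `t` depends on the previous decisions and on what has been observed
  of the durations of the previous uses by the time `a t` -/
  nonanticipating : ∀ t ω ω',
    (∀ τ < t, dec τ ω = dec τ ω' ∧ ∀ i k, dec τ ω = some (i, k) →
      observed (P.a t - P.a τ) (ω τ i) = observed (P.a t - P.a τ) (ω' τ i)) →
    dec t ω = dec t ω'

/-- The reward that a policy collects from arrival `t` on the sample path `ω`. -/
def OfflinePolicy.gain {P : RentalInstance I} (π : P.OfflinePolicy) (t : Fin P.T)
    (ω : P.SamplePath) : ℝ :=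
  match π.dec t ω with
  | some (i, _) => P.rew i (ω t i)
  | none => 0

/-- The expected total reward of an offline policy. -/
def OfflinePolicy.reward [Fintype I] {P : RentalInstance I} (π : P.OfflinePolicy) : ℝ :=
  ∫ ω, ∑ t, π.gain t ω ∂P.pathLaw

/-- The expected total reward of the clairvoyant optimum. -/
def opt [Fintype I] : ℝ := ⨆ π : P.OfflinePolicy, π.reward

/-! ### The definitions make sense -/

/-- An argmax rule exists. -/
theorem exists_isArgmaxRule [Nonempty I] : ∃ sel, P.IsArgmaxRule sel := by
  classical
  have h : ∀ (t : ℕ) (κ : I → ℕ), ∃ i, (P.nbr t).Nonempty →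
      i ∈ P.nbr t ∧ ∀ j ∈ P.nbr t, P.price j (κ j) ≤ P.price i (κ i) := by
    intro t κ
    by_cases hn : (P.nbr t).Nonempty
    · obtain ⟨i, hi, hmax⟩ := (P.nbr t).exists_max_image (fun j => P.price j (κ j)) hn
      exact ⟨i, fun _ => ⟨hi, hmax⟩⟩
    · exact ⟨Classical.arbitrary I, fun h => absurd h hn⟩
  choose sel hsel using h
  exact ⟨sel, fun t _ hn κ => hsel t κ hn⟩

/-- The number of units of which a positive fraction is available. -/
def numAvailable [Fintype I] (z : I → ℕ → ℝ) : ℕ :=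
  ∑ i, ((Finset.Icc 1 (P.cap i)).filter (fun k => 0 < z i k)).card

theorem highest_mem (z : I → ℕ → ℝ) (i : I) (h : P.highest z i ≠ 0) :
    P.highest z i ∈ (Finset.Icc 1 (P.cap i)).filter (fun k => 0 < z i k) := by
  have hne : ((Finset.Icc 1 (P.cap i)).filter (fun k => 0 < z i k)).Nonempty := by
    by_contra hc
    rw [Finset.not_nonempty_iff_eq_empty] at hc
    exact h (by simp [highest, hc])
  obtain ⟨k, hk, hk'⟩ := Finset.exists_mem_eq_sup _ hne id
  unfold highest
  rw [hk']
  exact hk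

theorem loopBody_of_not_continues (sel : ℕ → (I → ℕ) → I) (t : ℕ) (s : LoopState I)
    (h : ¬ P.Continues sel t s) : P.loopBody sel t s = s := by
  simp [loopBody, h]

theorem loopBody_progress [Fintype I] (sel : ℕ → (I → ℕ) → I) (t : ℕ) (s : LoopState I)
    (h : P.Continues sel t s) (h' : P.Continues sel t (P.loopBody sel t s)) :
    P.numAvailable (P.loopBody sel t s).z < P.numAvailable s.z := by
  classical
  have hk := P.highest_mem s.z (sel t (P.highest s.z)) h.2.2
  have heta := h'.1
  simp only [loopBody, h, if_true] at heta ⊢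
  set i' := sel t (P.highest s.z)
  set k' := P.highest s.z i'
  have hpos : 0 < s.z i' k' := (Finset.mem_filter.1 hk).2
  have hmin : min (s.z i' k') (1 - s.eta) = s.z i' k' := by
    rcases min_choice (s.z i' k') (1 - s.eta) with hm | hm
    · exact hm
    · rw [hm] at heta
      linarith
  rw [hmin]
  have hsub : ∀ i, (Finset.Icc 1 (P.cap i)).filter (fun k =>
      0 < (if i = i' ∧ k = k' then s.z i k - s.z i' k' else s.z i k)) ⊆
      (Finset.Icc 1 (P.cap i)).filter (fun k => 0 < s.z i k) := by
    intro i k hk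
    rw [Finset.mem_filter] at hk ⊢
    refine ⟨hk.1, ?_⟩
    have h2 := hk.2
    split_ifs at h2 with hc
    · linarith
    · exact h2
  unfold numAvailable
  refine Finset.sum_lt_sum (fun i _ => Finset.card_le_card (hsub i)) ⟨i', Finset.mem_univ _, ?_⟩
  refine Finset.card_lt_card ⟨hsub i', fun hc => ?_⟩
  have := hc hk
  rw [Finset.mem_filter] at this
  simp at this

/-- The inner loop has ended after `∑ i, c i` rounds. -/
theorem not_continues_loop [Fintype I] (sel : ℕ → (I → ℕ) → I) (t : ℕ) (z : I → ℕ → ℝ) :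
    ¬ P.Continues sel t (P.loop sel t z) := by
  classical
  have key : ∀ n, P.Continues sel t
      ((P.loopBody sel t)^[n] { eta := 0, z := z, y := fun _ _ => 0 }) →
      P.numAvailable ((P.loopBody sel t)^[n] { eta := 0, z := z, y := fun _ _ => 0 }).z + n ≤
        ∑ i, P.cap i := by
    intro n
    induction n with
    | zero =>
      intro _
      refine Finset.sum_le_sum fun i _ => ?_
      exact (Finset.card_filter_le _ _).trans (by simp)
    | succ n ih =>
      intro h
      rw [Function.iterate_succ_apply'] at h ⊢
      by_cases hc : P.Continues sel t
          ((P.loopBody sel t)^[n] { eta := 0, z := z, y := fun _ _ => 0 })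
      · have h1 := ih hc
        have h2 := P.loopBody_progress sel t _ hc h
        omega
      · rw [P.loopBody_of_not_continues sel t _ hc] at h
        exact absurd h hc
  intro h
  have h1 := key _ h
  have h2 := P.highest_mem _ _ h.2.2
  have h3 : 0 < P.numAvailable (P.loop sel t z).z := by
    refine lt_of_lt_of_le (Finset.card_pos.2 ⟨_, h2⟩) ?_
    exact Finset.single_le_sum (f := fun i => ((Finset.Icc 1 (P.cap i)).filter
      (fun k => 0 < (P.loop sel t z).z i k)).card) (fun _ _ => Nat.zero_le _) (Finset.mem_univ _)
  unfold loop at h3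
  omega

theorem integrable_rew_path [Fintype I] (t : Fin P.T) (i : I) :
    Integrable (fun ω : P.SamplePath => P.rew i (ω t i)) P.pathLaw := by
  have h1 : MeasurePreserving (Function.eval i) (Measure.pi P.law) (P.law i) :=
    measurePreserving_eval P.law i
  have h2 : MeasurePreserving (Function.eval t) P.pathLaw (Measure.pi P.law) :=
    measurePreserving_eval (fun _ : Fin P.T => Measure.pi P.law) t
  exact ((h1.comp h2).integrable_comp (P.rew_integrable i).aestronglyMeasurable).2
    (P.rew_integrable i)

theorem OfflinePolicy.gain_nonneg {P : RentalInstance I} (π : P.OfflinePolicy)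
    (t : Fin P.T) (ω : P.SamplePath) : 0 ≤ π.gain t ω := by
  unfold OfflinePolicy.gain
  split
  · exact P.rew_nonneg _ _
  · exact le_rfl

theorem OfflinePolicy.gain_le [Fintype I] {P : RentalInstance I} (π : P.OfflinePolicy)
    (t : Fin P.T) (ω : P.SamplePath) : π.gain t ω ≤ ∑ i, P.rew i (ω t i) := by
  unfold OfflinePolicy.gain
  split
  · rename_i i _ _
    exact Finset.single_le_sum (f := fun i => P.rew i (ω t i))
      (fun i _ => P.rew_nonneg i _) (Finset.mem_univ i)
  · exact Finset.sum_nonneg fun i _ => P.rew_nonneg i _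

/-- The total reward of a policy is integrable. -/
theorem OfflinePolicy.integrable_gain [Fintype I] {P : RentalInstance I} (π : P.OfflinePolicy) :
    Integrable (fun ω => ∑ t, π.gain t ω) P.pathLaw := by
  classical
  refine integrable_finsetSum _ fun t _ => ?_
  have heq : π.gain t = fun ω => ∑ i, ∑ k ∈ Finset.Icc 1 (P.cap i),
      Set.indicator {ω | π.dec t ω = some (i, k)} (fun ω => P.rew i (ω t i)) ω := by
    funext ω
    unfold OfflinePolicy.gain
    split
    · rename_i i k h
      rw [Finset.sum_eq_single i, Finset.sum_eq_single k]
      · simp [Set.indicator, h]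
      · intro k' _ hk'
        simp [Set.indicator, h, Ne.symm hk']
      · exact fun hk => absurd (π.edge t ω i k h).2 hk
      · intro i' _ hi'
        refine Finset.sum_eq_zero fun k' _ => ?_
        simp [Set.indicator, h, Ne.symm hi']
      · simp
    · rename_i h
      simp [Set.indicator, h]
  rw [heq]
  exact integrable_finsetSum _ fun i _ => integrable_finsetSum _ fun k _ =>
    (P.integrable_rew_path t i).indicator (π.measurable_dec t _)

/-- The rewards of the policies are bounded, so that `opt` is their least upper bound. -/
theorem bddAbove_reward [Fintype I] :
    BddAbove (Set.range fun π : P.OfflinePolicy => π.reward) := by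
  refine ⟨∫ ω, ∑ t, ∑ i, P.rew i (ω t i) ∂P.pathLaw, ?_⟩
  rintro _ ⟨π, rfl⟩
  refine integral_mono π.integrable_gain ?_ fun ω => Finset.sum_le_sum fun t _ => π.gain_le t ω
  exact integrable_finsetSum _ fun t _ => integrable_finsetSum _ fun i _ =>
    P.integrable_rew_path t i

/-- The policy that rejects every arrival. -/
instance : Nonempty P.OfflinePolicy :=
  ⟨{ dec := fun _ _ => none
     measurable_dec := fun _ _ => MeasurableSet.const _
     edge := by simp
     available := by simp
     nonanticipating := by simp }⟩

end

end RentalInstance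

/-! Fix an offline policy and let `p i t` be the probability that it matches `t` to `i`. Durations
are independent of the decisions that start them, so the policy earns `∑ r i * p i t`, and the
expected number of units of `i` in use right after any arrival is at most `c i`.

The algorithm always serves from the best reduced price, and these prices only fall while an arrival
is served. Hence what it pays in reduced prices for `t` is at least the reduced price left at every
neighbour of `t`. Averaging over `p` compares the policy with the algorithm, except that `i` is
credited with `1 - exp (-h / c)` instead of `1 - 1/e`, where `h` is the highest unit left.

The shortfall is the sum over units `k > h` of `exp (-(k-1)/c) - exp (-k/c)`. Whenever `h < k`, unit
`k` is fully in use in the fluid state, while the policy uses at most `c` units in expectation. Both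
use the same `F i`, so LP duality with a triangular kernel (`exists_triangular_weights`,
`sum_le_of_triangular`) shows that over these arrivals the policy matches at most `c` times the
total fluid use of unit `k`.

Charging all this to unit `k` gives the factor `1 - exp (-k/c) + exp (-k/c) * c * (exp (1/c) - 1) ≤
1 + 1/c`, hence `(1 - 1/e) * OPT ≤ (1 + 1/cmin) * GALG`. -/

/-! ### Duality for triangular kernels. -/

/-- Back substitution from the latest point of `A` to the earliest. The bound at every `τ`, also
outside `A`, is what makes the next weight non-negative. In the application `G τ t` is the fraction
of a match made at `τ` that is still in use after `t`. -/
theorem exists_triangular_weights {ι : Type*} [LinearOrder ι] (G : ι → ι → ℝ) (A : Finset ι)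
    (hdiag : ∀ t ∈ A, G t t = 1) (hzero : ∀ t ∈ A, ∀ τ, t < τ → G τ t = 0)
    (hmono : ∀ t ∈ A, ∀ τ τ', τ ≤ τ' → τ' ≤ t → G τ t ≤ G τ' t) :
    ∃ w : ι → ℝ, (∀ t, 0 ≤ w t) ∧ (∀ τ ∈ A, ∑ t ∈ A, w t * G τ t = 1) ∧
      ∀ τ, ∑ t ∈ A, w t * G τ t ≤ 1 := by
  induction A using Finset.induction_on_min with
  | empty => exact ⟨fun _ => 0, by simp⟩
  | insert a A ha ih =>
    have haA : a ∉ A := fun h => lt_irrefl _ (ha a h)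
    obtain ⟨w, hw0, hw1, hw2⟩ := ih (fun t ht => hdiag t (Finset.mem_insert_of_mem ht))
      (fun t ht => hzero t (Finset.mem_insert_of_mem ht))
      (fun t ht => hmono t (Finset.mem_insert_of_mem ht))
    -- The equation at the new minimum `a` forces this weight, since `G a a = 1`; later equations
    -- are unaffected because `G τ a = 0` for `τ > a`.
    set w' := Function.update w a (1 - ∑ t ∈ A, w t * G a t) with hw'
    have hw'0 : ∀ t, 0 ≤ w' t := by
      intro t
      rcases eq_or_ne t a with rfl | h
      · simpa [hw'] using hw2 t
      · simpa [hw', h] using hw0 t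
    have hsum : ∀ τ, ∑ t ∈ insert a A, w' t * G τ t =
        (1 - ∑ t ∈ A, w t * G a t) * G τ a + ∑ t ∈ A, w t * G τ t := by
      intro τ
      rw [Finset.sum_insert haA]
      congr 1
      · simp [hw']
      · refine Finset.sum_congr rfl fun t ht => ?_
        have : t ≠ a := fun h => haA (h ▸ ht)
        simp [hw', this]
    have hself : ∑ t ∈ insert a A, w' t * G a t = 1 := by
      rw [hsum, hdiag a (Finset.mem_insert_self a A)]
      ring
    refine ⟨w', hw'0, fun τ hτ => ?_, fun τ => ?_⟩
    · rcases Finset.mem_insert.1 hτ with rfl | h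
      · exact hself
      · rw [hsum, hzero a (Finset.mem_insert_self a A) τ (ha τ h), hw1 τ h]
        ring
    · rcases le_or_gt τ a with h | h
      · rw [← hself]
        refine Finset.sum_le_sum fun t ht => mul_le_mul_of_nonneg_left ?_ (hw'0 t)
        refine hmono t ht τ a h ?_
        rcases Finset.mem_insert.1 ht with rfl | h'
        · exact le_rfl
        · exact (ha t h').le
      · rw [hsum, hzero a (Finset.mem_insert_self a A) τ h, mul_zero, zero_add]
        exact hw2 τ

/-- Among the allocations `p` supported in `A` that never use more than `c` units, none is larger
than `c` times an allocation `y` that keeps a full unit in use at each point of `A`. -/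
theorem sum_le_of_triangular {ι : Type*} [LinearOrder ι] (G : ι → ι → ℝ) (A B : Finset ι)
    (hdiag : ∀ t ∈ A, G t t = 1) (hzero : ∀ t ∈ A, ∀ τ, t < τ → G τ t = 0)
    (hmono : ∀ t ∈ A, ∀ τ τ', τ ≤ τ' → τ' ≤ t → G τ t ≤ G τ' t)
    (p y : ι → ℝ) (c : ℝ) (hc : 0 ≤ c) (hy0 : ∀ τ ∈ B, 0 ≤ y τ)
    (hp : ∀ t ∈ A, ∑ τ ∈ A, p τ * G τ t ≤ c) (hy : ∀ t ∈ A, 1 ≤ ∑ τ ∈ B, y τ * G τ t) :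
    ∑ τ ∈ A, p τ ≤ c * ∑ τ ∈ B, y τ := by
  obtain ⟨w, hw0, hw1, hw2⟩ := exists_triangular_weights G A hdiag hzero hmono
  have swap : ∀ (S : Finset ι) (q : ι → ℝ), ∑ τ ∈ S, q τ * ∑ t ∈ A, w t * G τ t =
      ∑ t ∈ A, w t * ∑ τ ∈ S, q τ * G τ t := by
    intro S q
    simp only [Finset.mul_sum]
    rw [Finset.sum_comm]
    exact Finset.sum_congr rfl fun t _ => Finset.sum_congr rfl fun τ _ => by ring
  -- The weights act as dual variables: their total is compared with `p` through the equalities on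
  -- `A`, and with `y` through the inequalities on `B`.
  have h1 : ∑ τ ∈ A, p τ = ∑ t ∈ A, w t * ∑ τ ∈ A, p τ * G τ t := by
    rw [← swap]
    exact Finset.sum_congr rfl fun τ hτ => by rw [hw1 τ hτ, mul_one]
  have h2 : ∑ t ∈ A, w t ≤ ∑ τ ∈ B, y τ := by
    calc ∑ t ∈ A, w t ≤ ∑ t ∈ A, w t * ∑ τ ∈ B, y τ * G τ t :=
          Finset.sum_le_sum fun t ht => le_mul_of_one_le_right (hw0 t) (hy t ht)
      _ = ∑ τ ∈ B, y τ * ∑ t ∈ A, w t * G τ t := (swap B y).symm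
      _ ≤ ∑ τ ∈ B, y τ :=
          Finset.sum_le_sum fun τ hτ => mul_le_of_le_one_right (hy0 τ hτ) (hw2 τ)
  calc ∑ τ ∈ A, p τ = ∑ t ∈ A, w t * ∑ τ ∈ A, p τ * G τ t := h1
    _ ≤ ∑ t ∈ A, w t * c :=
        Finset.sum_le_sum fun t ht => mul_le_mul_of_nonneg_left (hp t ht) (hw0 t)
    _ = c * ∑ t ∈ A, w t := by rw [← Finset.sum_mul, mul_comm]
    _ ≤ c * ∑ τ ∈ B, y τ := mul_le_mul_of_nonneg_left h2 hc

/-! ### Monotonicity of returns, reduced prices and highest available units. -/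

namespace RentalInstance

noncomputable section

variable {I : Type*} (P : RentalInstance I)

theorem meanRew_nonneg (i : I) : 0 ≤ P.meanRew i := integral_nonneg fun d => P.rew_nonneg i d

theorem cdf_nonneg (i : I) (d : ℝ) : 0 ≤ P.cdf i d := measureReal_nonneg

theorem cdf_le_one (i : I) (d : ℝ) : P.cdf i d ≤ 1 := measureReal_le_one

theorem cdf_mono (i : I) : Monotone (P.cdf i) := fun _ _ h =>
  measureReal_mono (Set.Iic_subset_Iic.2 (ENNReal.ofReal_le_ofReal h))

theorem returned_le_one (i : I) (τ t : ℕ) : P.returned i τ t ≤ 1 := by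
  unfold returned
  split_ifs
  · exact P.cdf_le_one _ _
  · exact zero_le_one

theorem returned_self (i : I) (t : ℕ) : P.returned i t t = 0 := by simp [returned]

theorem returned_nonneg (i : I) (τ t : ℕ) : 0 ≤ P.returned i τ t := by
  unfold returned
  split_ifs
  · exact P.cdf_nonneg _ _
  · exact le_rfl

theorem a_le {s t : ℕ} (h : s ≤ t) (ht : t < P.T) : P.a s ≤ P.a t :=
  P.a_strictMono.monotoneOn (show s ∈ Set.Iio P.T from h.trans_lt ht) ht h

theorem returned_mono (i : I) (τ : ℕ) {s t : ℕ} (h : s ≤ t) (ht : t < P.T) :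
    P.returned i τ s ≤ P.returned i τ t := by
  by_cases hs : τ < s
  · simp only [returned, hs, hs.trans_le h, if_true]
    exact P.cdf_mono i (sub_le_sub_right (P.a_le h ht) _)
  · rw [returned, if_neg hs]
    exact P.returned_nonneg i τ t

/-- All uses of `i` share one distribution, so the older use has returned at least as much. This is
the monotonicity required of the kernel. -/
theorem returned_anti (i : I) {τ τ' t : ℕ} (h : τ ≤ τ') (ht : t < P.T) :
    P.returned i τ' t ≤ P.returned i τ t := by
  by_cases hs : τ' < t
  · simp only [returned, hs, h.trans_lt hs, if_true]
    exact P.cdf_mono i (sub_le_sub_left (P.a_le h (hs.trans ht)) _)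
  · rw [returned, if_neg hs]
    exact P.returned_nonneg i τ t

theorem price_mono (i : I) : Monotone (P.price i) := by
  intro k l h
  refine mul_le_mul_of_nonneg_left ?_ (P.meanRew_nonneg i)
  have h1 : (k : ℝ) / P.cap i ≤ (l : ℝ) / P.cap i := by gcongr
  have := Real.exp_le_exp.2 (neg_le_neg h1)
  linarith

theorem price_zero (i : I) : P.price i 0 = 0 := by simp [price]

theorem price_nonneg (i : I) (k : ℕ) : 0 ≤ P.price i k := by
  rw [← P.price_zero i]
  exact P.price_mono i (Nat.zero_le k)

theorem highest_anti {z z' : I → ℕ → ℝ} (h : ∀ i k, z i k ≤ z' i k) (i : I) :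
    P.highest z i ≤ P.highest z' i :=
  Finset.sup_mono fun _ hk => by
    rw [Finset.mem_filter] at hk ⊢
    exact ⟨hk.1, hk.2.trans_le (h i _)⟩

theorem highest_le_cap (z : I → ℕ → ℝ) (i : I) : P.highest z i ≤ P.cap i :=
  Finset.sup_le fun _ hk => (Finset.mem_Icc.1 (Finset.mem_filter.1 hk).1).2

theorem le_zero_of_highest_lt (z : I → ℕ → ℝ) (i : I) {k : ℕ} (hk : k ∈ Finset.Icc 1 (P.cap i))
    (h : P.highest z i < k) : z i k ≤ 0 := by
  by_contra hc
  have : id k ≤ P.highest z i :=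
    Finset.le_sup (f := id) (Finset.mem_filter.2 ⟨hk, not_le.1 hc⟩)
  exact absurd h (not_lt.2 this)

theorem fluidUpdate_nonneg {n : ℕ} (hn : n < P.T) {s : FluidState I} (hz : ∀ i k, 0 ≤ s.z i k)
    (hy : ∀ τ i k, 0 ≤ s.y τ i k) (i : I) (k : ℕ) : 0 ≤ P.fluidUpdate n s i k :=
  add_nonneg (hz i k) (Finset.sum_nonneg fun τ _ =>
    mul_nonneg (sub_nonneg.2 (P.returned_mono i τ (Nat.sub_le n 1) hn)) (hy τ i k))

/-! ### The inner loop. -/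

variable [Fintype I]

/-- The invariants of the inner loop for arrival `t`, started with available fractions `z₀`. -/
structure LoopInvariant (t : ℕ) (z₀ : I → ℕ → ℝ) (s : LoopState I) : Prop where
  z_nonneg : ∀ i k, 0 ≤ s.z i k
  y_nonneg : ∀ i k, 0 ≤ s.y i k
  z_add_y : ∀ i k, s.z i k + s.y i k = z₀ i k
  eta_le : s.eta ≤ 1
  eta_mul_le : ∀ j ∈ P.nbr t, s.eta * P.price j (P.highest s.z j) ≤
    ∑ i, ∑ k ∈ Finset.Icc 1 (P.cap i), P.price i k * s.y i k
  eta_nonneg : 0 ≤ s.eta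

/-- For `eta_mul_le`: the amount added in a round is paid at the current maximal price, and the
prices of the highest available units can only drop, so earlier payments still dominate. -/
theorem LoopInvariant.loopBody {P : RentalInstance I} {sel : ℕ → (I → ℕ) → I}
    (hsel : P.IsArgmaxRule sel) {t : ℕ} (ht : t < P.T) {z₀ : I → ℕ → ℝ} {s : LoopState I}
    (hs : P.LoopInvariant t z₀ s) : P.LoopInvariant t z₀ (P.loopBody sel t s) := by
  classical
  by_cases hc : P.Continues sel t s
  swap
  · rwa [P.loopBody_of_not_continues sel t s hc]
  have hk := Finset.mem_filter.1 (P.highest_mem s.z (sel t (P.highest s.z)) hc.2.2)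
  obtain ⟨-, hmax⟩ := hsel t ht hc.2.1 (P.highest s.z)
  have heta := hc.1
  simp only [RentalInstance.loopBody, hc, if_true]
  set i' := sel t (P.highest s.z)
  set k' := P.highest s.z i'
  set m := min (s.z i' k') (1 - s.eta) with hm
  have hm0 : 0 ≤ m := le_min hk.2.le (by linarith)
  have hm1 : m ≤ s.z i' k' := min_le_left _ _
  have hm2 : m ≤ 1 - s.eta := min_le_right _ _
  refine ⟨fun i k => ?_, fun i k => ?_, fun i k => ?_, ?_, fun j hj => ?_, ?_⟩
  · dsimp only
    split_ifs with h
    · rw [h.1, h.2]; linarith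
    · exact hs.z_nonneg i k
  · dsimp only
    have := hs.y_nonneg i k
    split_ifs with h
    · linarith
    · exact this
  · dsimp only
    have := hs.z_add_y i k
    split_ifs with h <;> linarith
  · dsimp only; linarith
  · dsimp only
    have hle : ∀ i k, (if i = i' ∧ k = k' then s.z i k - m else s.z i k) ≤ s.z i k := by
      intro i k
      split_ifs <;> linarith
    have h1 := P.price_mono j (P.highest_anti hle j)
    have h2 : ∑ i, ∑ k ∈ Finset.Icc 1 (P.cap i),
        P.price i k * (if i = i' ∧ k = k' then s.y i k + m else s.y i k) =
        (∑ i, ∑ k ∈ Finset.Icc 1 (P.cap i), P.price i k * s.y i k) + P.price i' k' * m := by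
      have h3 : ∀ i k, P.price i k * (if i = i' ∧ k = k' then s.y i k + m else s.y i k) =
          P.price i k * s.y i k + if i = i' then (if k = k' then P.price i k * m else 0) else 0 := by
        intro i k
        by_cases h : i = i' <;> by_cases h' : k = k' <;> simp [h, h', mul_add]
      simp only [h3, Finset.sum_add_distrib]
      congr 1
      rw [Finset.sum_eq_single i' (fun i _ h => by simp [h]) (by simp)]
      rw [Finset.sum_eq_single k' (fun k _ h => by simp [h]) (fun h => absurd hk.1 h)]
      simp
    rw [h2]
    calc _ ≤ (s.eta + m) * P.price j (P.highest s.z j) :=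
          mul_le_mul_of_nonneg_left h1 (by linarith [hs.eta_nonneg])
      _ = s.eta * P.price j (P.highest s.z j) + P.price j (P.highest s.z j) * m := by ring
      _ ≤ _ := add_le_add (hs.eta_mul_le j hj) (mul_le_mul_of_nonneg_right (hmax j hj) hm0)
  · dsimp only; linarith [hs.eta_nonneg]

theorem loopInvariant_loop {sel : ℕ → (I → ℕ) → I} (hsel : P.IsArgmaxRule sel) {t : ℕ}
    (ht : t < P.T) {z : I → ℕ → ℝ} (hz : ∀ i k, 0 ≤ z i k) :
    P.LoopInvariant t z (P.loop sel t z) := by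
  unfold loop
  generalize ∑ i, P.cap i = n
  induction n with
  | zero => exact ⟨hz, by simp, by simp, by simp, by simp, by simp⟩
  | succ n ih =>
    rw [Function.iterate_succ_apply']
    exact ih.loopBody hsel ht

/-- The loop ends either with the arrival fully served, where the invariant at `eta = 1` is the
claim, or with a maximal price of zero, where the left side is at most `0`. -/
theorem price_highest_loop_le {sel : ℕ → (I → ℕ) → I} (hsel : P.IsArgmaxRule sel) {t : ℕ}
    (ht : t < P.T) {z : I → ℕ → ℝ} (hz : ∀ i k, 0 ≤ z i k) {j : I} (hj : j ∈ P.nbr t) :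
    P.price j (P.highest (P.loop sel t z).z j) ≤
      ∑ i, ∑ k ∈ Finset.Icc 1 (P.cap i), P.price i k * (P.loop sel t z).y i k := by
  have hinv := P.loopInvariant_loop hsel ht hz
  have hend := P.not_continues_loop sel t z
  set s := P.loop sel t z
  by_cases h1 : s.eta < 1
  · have h2 : P.highest s.z (sel t (P.highest s.z)) = 0 := by
      by_contra h
      exact hend ⟨h1, ⟨j, hj⟩, h⟩
    have h3 := (hsel t ht ⟨j, hj⟩ (P.highest s.z)).2 j hj
    rw [h2, P.price_zero] at h3
    exact h3.trans (Finset.sum_nonneg fun i _ => Finset.sum_nonneg fun k _ =>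
      mul_nonneg (P.price_nonneg i k) (hinv.y_nonneg i k))
  · have h2 : s.eta = 1 := le_antisymm hinv.eta_le (not_lt.1 h1)
    simpa [h2] using hinv.eta_mul_le j hj

/-! ### Fluid accounting across arrivals. -/

theorem fluidState_y_of_lt (sel : ℕ → (I → ℕ) → I) {t m n : ℕ} (htm : t < m) (hmn : m ≤ n) :
    (P.fluidState sel n).y t = (P.fluidState sel m).y t := by
  induction n, hmn using Nat.le_induction with
  | base => rfl
  | succ n hn ih =>
    rw [← ih]
    simp only [fluidState]
    exact Function.update_of_ne (by omega) _ _

theorem fluidState_nonneg {sel : ℕ → (I → ℕ) → I} (hsel : P.IsArgmaxRule sel) {n : ℕ}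
    (hn : n ≤ P.T) : (∀ i k, 0 ≤ (P.fluidState sel n).z i k) ∧
      ∀ τ i k, 0 ≤ (P.fluidState sel n).y τ i k := by
  induction n with
  | zero => simp [fluidState]
  | succ n ih =>
    obtain ⟨hz, hy⟩ := ih (by omega)
    have hinv := P.loopInvariant_loop hsel hn (P.fluidUpdate_nonneg hn hz hy)
    refine ⟨hinv.z_nonneg, fun τ i k => ?_⟩
    simp only [fluidState]
    rcases eq_or_ne τ n with rfl | h
    · simpa using hinv.y_nonneg i k
    · simpa [h] using hy τ i k

/-- Conservation: the increments of `returned` telescope, so what is available is one minus what is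
in use. The last arrival served is `n - 1`; for `n = 0` the truncation is harmless because the sum
is empty. -/
theorem fluidState_z_eq {sel : ℕ → (I → ℕ) → I} (hsel : P.IsArgmaxRule sel) {n : ℕ}
    (hn : n ≤ P.T) (i : I) (k : ℕ) : (P.fluidState sel n).z i k =
      1 - ∑ τ ∈ Finset.range n, (P.fluidState sel n).y τ i k * (1 - P.returned i τ (n - 1)) := by
  induction n with
  | zero => simp [fluidState]
  | succ n ih =>
    have ih := ih (by omega)
    obtain ⟨hz, hy⟩ := P.fluidState_nonneg hsel (n := n) (by omega)
    have h1 := (P.loopInvariant_loop hsel hn (P.fluidUpdate_nonneg hn hz hy)).z_add_y i k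
    have h2 : P.fluidUpdate n (P.fluidState sel n) i k =
        1 - ∑ τ ∈ Finset.range n, (P.fluidState sel n).y τ i k * (1 - P.returned i τ n) := by
      rw [fluidUpdate, ih, sub_add, ← Finset.sum_sub_distrib]
      congr 1
      exact Finset.sum_congr rfl fun τ _ => by ring
    have h3 : ∑ τ ∈ Finset.range n, (P.fluidState sel (n + 1)).y τ i k * (1 - P.returned i τ n) =
        ∑ τ ∈ Finset.range n, (P.fluidState sel n).y τ i k * (1 - P.returned i τ n) :=
      Finset.sum_congr rfl fun τ hτ => by
        rw [P.fluidState_y_of_lt sel (Finset.mem_range.1 hτ) n.le_succ]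
    rw [Finset.sum_range_succ, Nat.add_sub_cancel, h3, P.returned_self]
    simp only [fluidState, Function.update_self]
    linarith

theorem price_highest_fluidState_le {sel : ℕ → (I → ℕ) → I} (hsel : P.IsArgmaxRule sel) {t : ℕ}
    (ht : t < P.T) {j : I} (hj : j ∈ P.nbr t) :
    P.price j (P.highest (P.fluidState sel (t + 1)).z j) ≤
      ∑ i, ∑ k ∈ Finset.Icc 1 (P.cap i), P.price i k * (P.fluidState sel P.T).y t i k := by
  obtain ⟨hz, hy⟩ := P.fluidState_nonneg hsel ht.le
  have h := P.price_highest_loop_le hsel ht (P.fluidUpdate_nonneg ht hz hy) hj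
  rw [P.fluidState_y_of_lt sel t.lt_succ_self ht]
  simpa only [fluidState, Function.update_self] using h

/-- If the units `k, k + 1, …` of resource `i` are exhausted after each arrival in `A`, then an
allocation to `A` that never uses more than `c` units is at most `c` times what the fluid algorithm
allocates of unit `k`. -/
theorem sum_le_mul_sum_fluidState {sel : ℕ → (I → ℕ) → I} (hsel : P.IsArgmaxRule sel) (i : I)
    {k : ℕ} (hk : k ∈ Finset.Icc 1 (P.cap i)) (p : ℕ → ℝ) (hp0 : ∀ t, 0 ≤ p t) (c : ℝ) (hc : 0 ≤ c)
    (hp : ∀ t < P.T, ∑ τ ∈ Finset.range (t + 1), p τ * (1 - P.returned i τ t) ≤ c) :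
    ∑ t ∈ (Finset.range P.T).filter
        (fun t => P.highest (P.fluidState sel (t + 1)).z i < k), p t ≤
      c * ∑ t ∈ Finset.range P.T, (P.fluidState sel P.T).y t i k := by
  set A := (Finset.range P.T).filter (fun t => P.highest (P.fluidState sel (t + 1)).z i < k)
    with hA
  have hAT : ∀ t ∈ A, t < P.T := fun t ht => Finset.mem_range.1 (Finset.mem_filter.1 ht).1
  -- The fraction in use right after `t`, cut off for `τ > t`, where `returned` is `0` and would
  -- give `1`. The diagonal is `1` because nothing returns before its own arrival has been served.
  set G : ℕ → ℕ → ℝ := fun τ t => if t < τ then 0 else 1 - P.returned i τ t with hG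
  have hG0 : ∀ τ t, 0 ≤ G τ t := by
    intro τ t
    simp only [hG]
    split_ifs
    · exact le_rfl
    · linarith [P.returned_le_one i τ t]
  have hsum : ∀ t < P.T, ∀ q : ℕ → ℝ, ∑ τ ∈ Finset.range P.T, q τ * G τ t =
      ∑ τ ∈ Finset.range (t + 1), q τ * (1 - P.returned i τ t) := by
    intro t ht q
    rw [← Finset.sum_subset (Finset.range_subset_range.2 (Nat.succ_le_of_lt ht))]
    · refine Finset.sum_congr rfl fun τ hτ => ?_
      rw [Finset.mem_range] at hτ
      simp only [hG]
      rw [if_neg (by omega)]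
    · intro τ _ hτ
      rw [Finset.mem_range] at hτ
      simp only [hG]
      rw [if_pos (by omega), mul_zero]
  refine sum_le_of_triangular G A (Finset.range P.T) ?_ ?_ ?_ p _ c hc
    (fun τ _ => (P.fluidState_nonneg hsel le_rfl).2 τ i k) ?_ ?_
  · intro t _
    simp [hG, P.returned_self]
  · intro t _ τ h
    simp [hG, h]
  · intro t ht τ τ' h h'
    simp only [hG]
    rw [if_neg (by omega), if_neg (by omega)]
    linarith [P.returned_anti i h (hAT t ht)]
  · intro t ht
    refine le_trans ?_ (hp t (hAT t ht))
    rw [← hsum t (hAT t ht)]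
    exact Finset.sum_le_sum_of_subset_of_nonneg (Finset.filter_subset _ _)
      fun τ _ _ => mul_nonneg (hp0 τ) (hG0 τ t)
  · intro t ht
    rw [hsum t (hAT t ht)]
    -- Nothing of unit `k` is available after `t`, so by conservation a full unit is in use.
    have h1 := P.le_zero_of_highest_lt _ i hk (Finset.mem_filter.1 ht).2
    rw [P.fluidState_z_eq hsel (Nat.succ_le_of_lt (hAT t ht)), Nat.succ_sub_one] at h1
    have h2 : ∑ τ ∈ Finset.range (t + 1),
        (P.fluidState sel (t + 1)).y τ i k * (1 - P.returned i τ t) =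
        ∑ τ ∈ Finset.range (t + 1),
          (P.fluidState sel P.T).y τ i k * (1 - P.returned i τ t) :=
      Finset.sum_congr rfl fun τ hτ => by
        rw [P.fluidState_y_of_lt sel (Finset.mem_range.1 hτ) (hAT t ht)]
    linarith

end

end RentalInstance

/-! ### Match probabilities of an offline policy. -/

namespace RentalInstance

noncomputable section

variable {I : Type*}

namespace OfflinePolicy

/-- A decision depends only on the durations of the earlier uses. -/
theorem dec_congr {P : RentalInstance I} (π : P.OfflinePolicy) (t : Fin P.T)
    {ω ω' : P.SamplePath} (h : ∀ τ < t, ω τ = ω' τ) : π.dec t ω = π.dec t ω' := by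
  induction t using WellFoundedLT.induction with
  | ind t ih =>
    exact π.nonanticipating t ω ω' fun τ hτ =>
      ⟨ih τ hτ fun σ hσ => h σ (hσ.trans hτ), fun i k _ => by rw [h τ hτ]⟩

variable [Fintype I] {P : RentalInstance I} (π : P.OfflinePolicy)

instance : IsProbabilityMeasure P.pathLaw := by
  unfold pathLaw
  infer_instance

theorem map_eval_pathLaw (P : RentalInstance I) (t : Fin P.T) (i : I) :
    MeasurePreserving (fun ω : P.SamplePath => ω t i) P.pathLaw (P.law i) :=
  (measurePreserving_eval P.law i).comp
    (measurePreserving_eval (fun _ : Fin P.T => Measure.pi P.law) t)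

/-- The decision on `t` is a function of the coordinates before `t`, which are independent of
coordinate `t`. -/
theorem indepFun_dec (t : Fin P.T) (m : Option (I × ℕ)) :
    ProbabilityTheory.IndepFun (Set.indicator {ω | π.dec t ω = m} (fun _ => (1 : ℝ)))
      (fun ω : P.SamplePath => ω t) P.pathLaw := by
  classical
  have h1 : ProbabilityTheory.iIndepFun (fun (τ : Fin P.T) (ω : P.SamplePath) => ω τ)
      P.pathLaw :=
    ProbabilityTheory.iIndepFun_pi (X := fun _ x => x) fun _ => aemeasurable_id
  have h2 := h1.indepFun_finset (Finset.Iio t) {t} (by simp) fun τ => measurable_pi_apply τ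
  -- Padding the past with arbitrary durations (here `0`) does not change the decision, by
  -- `dec_congr`, and exhibits it as a measurable function of the past.
  let ext : ((τ : Finset.Iio t) → I → ℝ≥0∞) → P.SamplePath :=
    fun v τ => if h : τ ∈ Finset.Iio t then v ⟨τ, h⟩ else 0
  have hext : Measurable ext := by
    refine measurable_pi_lambda _ fun τ => ?_
    by_cases h : τ ∈ Finset.Iio t
    · simpa only [ext, h, dif_pos] using measurable_pi_apply _
    · simpa only [ext, h, dif_neg, not_false_iff] using measurable_const
  have hdec : ∀ ω : P.SamplePath, π.dec t (ext fun τ => ω τ) = π.dec t ω := fun ω =>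
    π.dec_congr t fun τ hτ => by simp [ext, hτ]
  have hlast : Measurable fun v : (({t} : Finset (Fin P.T)) → I → ℝ≥0∞) =>
      v ⟨t, Finset.mem_singleton_self t⟩ := measurable_pi_apply _
  have hfirst : Measurable fun v =>
      Set.indicator {ω | π.dec t ω = m} (fun _ => (1 : ℝ)) (ext v) :=
    (measurable_const.indicator (π.measurable_dec t m)).comp hext
  have h3 := h2.comp
    (φ := fun v => Set.indicator {ω | π.dec t ω = m} (fun _ => (1 : ℝ)) (ext v))
    (ψ := fun v => v ⟨t, Finset.mem_singleton_self t⟩)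
    hfirst hlast
  convert h3 using 1
  · funext ω
    simp only [Function.comp, Set.indicator, Set.mem_ofPred_eq, hdec]
  · rfl

/-- Used twice: with `f` the reward, for the value of the policy, and with `f` the indicator of long
durations, for the probability that a unit is still in use. -/
theorem integral_indicator_dec (t : Fin P.T) (m : Option (I × ℕ)) (i : I) {f : ℝ≥0∞ → ℝ}
    (hf : Measurable f) :
    ∫ ω, Set.indicator {ω | π.dec t ω = m} (fun ω => f (ω t i)) ω ∂P.pathLaw =
      P.pathLaw.real {ω | π.dec t ω = m} * ∫ d, f d ∂P.law i := by
  have hfi : Measurable fun x : I → ℝ≥0∞ => f (x i) := hf.comp (measurable_pi_apply i)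
  have h1 := (π.indepFun_dec t m).comp (φ := id) (ψ := fun x => f (x i)) measurable_id hfi
  have h2 := h1.integral_fun_mul_eq_mul_integral
    (measurable_const.indicator (π.measurable_dec t m)).aestronglyMeasurable
    (hfi.comp (measurable_pi_apply t)).aestronglyMeasurable
  have h3 : ∫ ω, Set.indicator {ω | π.dec t ω = m} (fun _ => (1 : ℝ)) ω ∂P.pathLaw =
      P.pathLaw.real {ω | π.dec t ω = m} :=
    integral_indicator_one (π.measurable_dec t m)
  have hmp := map_eval_pathLaw P t i
  have h4 : ∫ ω : P.SamplePath, f (ω t i) ∂P.pathLaw = ∫ d, f d ∂P.law i := by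
    rw [← hmp.map_eq, integral_map hmp.measurable.aemeasurable hf.aestronglyMeasurable]
  rw [← h3, ← h4]
  refine Eq.trans ?_ h2
  refine integral_congr_ae (Filter.Eventually.of_forall fun ω => ?_)
  by_cases h : π.dec t ω = m <;> simp [h]

theorem gain_eq_sum (t : Fin P.T) (ω : P.SamplePath) :
    π.gain t ω = ∑ i, ∑ k ∈ Finset.Icc 1 (P.cap i),
      Set.indicator {ω | π.dec t ω = some (i, k)} (fun ω => P.rew i (ω t i)) ω := by
  classical
  unfold OfflinePolicy.gain
  split
  · rename_i i k h
    rw [Finset.sum_eq_single i, Finset.sum_eq_single k]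
    · simp [h]
    · intro k' _ hk'
      simp [h, Ne.symm hk']
    · exact fun hk => absurd (π.edge t ω i k h).2 hk
    · intro i' _ hi'
      refine Finset.sum_eq_zero fun k' _ => ?_
      simp [h, Ne.symm hi']
    · simp
  · rename_i h
    simp [h]

/-- The probability that arrival `t` is matched to unit `k` of resource `i`. -/
def unitProb (t : Fin P.T) (i : I) (k : ℕ) : ℝ :=
  P.pathLaw.real {ω | π.dec t ω = some (i, k)}

/-- The probability that arrival `t` is matched to resource `i`. -/
def matchProb (i : I) (t : ℕ) : ℝ :=
  if h : t < P.T then ∑ k ∈ Finset.Icc 1 (P.cap i), π.unitProb ⟨t, h⟩ i k else 0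

theorem matchProb_nonneg (i : I) (t : ℕ) : 0 ≤ π.matchProb i t := by
  unfold matchProb
  split_ifs
  · exact Finset.sum_nonneg fun k _ => measureReal_nonneg
  · exact le_rfl

theorem mem_nbr_of_matchProb_ne_zero {i : I} {t : ℕ} (h : π.matchProb i t ≠ 0) :
    i ∈ P.nbr t := by
  by_contra hi
  refine h ?_
  unfold matchProb
  split_ifs with ht
  · refine Finset.sum_eq_zero fun k _ => ?_
    have : {ω | π.dec ⟨t, ht⟩ ω = some (i, k)} = ∅ :=
      Set.eq_empty_of_forall_notMem fun ω hω => hi (π.edge _ ω i k hω).1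
    simp [unitProb, this]
  · rfl

theorem reward_eq : π.reward = ∑ i, P.meanRew i * ∑ t ∈ Finset.range P.T, π.matchProb i t := by
  have hint : ∀ (t : Fin P.T) (i : I) (k : ℕ), Integrable (fun ω =>
      Set.indicator {ω | π.dec t ω = some (i, k)} (fun ω => P.rew i (ω t i)) ω) P.pathLaw :=
    fun t i k => (P.integrable_rew_path t i).indicator (π.measurable_dec t _)
  unfold OfflinePolicy.reward
  simp only [gain_eq_sum]
  rw [integral_finsetSum _ fun t _ => integrable_finsetSum _ fun i _ =>
    integrable_finsetSum _ fun k _ => hint t i k]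
  have h1 : ∀ t : Fin P.T, ∫ ω, ∑ i, ∑ k ∈ Finset.Icc 1 (P.cap i),
      Set.indicator {ω | π.dec t ω = some (i, k)} (fun ω => P.rew i (ω t i)) ω ∂P.pathLaw =
      ∑ i, P.meanRew i * π.matchProb i t := by
    intro t
    rw [integral_finsetSum _ fun i _ => integrable_finsetSum _ fun k _ => hint t i k]
    refine Finset.sum_congr rfl fun i _ => ?_
    rw [integral_finsetSum _ fun k _ => hint t i k]
    simp only [matchProb, t.isLt, dif_pos, Finset.mul_sum]
    refine Finset.sum_congr rfl fun k _ => ?_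
    rw [π.integral_indicator_dec t (some (i, k)) i (P.rew_mono i).measurable, mul_comm]
    rfl
  simp only [h1, Finset.mul_sum]
  rw [Finset.sum_comm]
  exact Finset.sum_congr rfl fun i _ =>
    Fin.sum_univ_eq_sum_range (fun t => P.meanRew i * π.matchProb i t) P.T

theorem sum_matchProb_le_one (t : ℕ) : ∑ i, π.matchProb i t ≤ 1 := by
  classical
  by_cases ht : t < P.T
  swap
  · simp [matchProb, ht]
  simp only [matchProb, ht, dif_pos, unitProb]
  rw [Finset.sum_sigma']
  rw [← measureReal_biUnion_finset]
  · exact measureReal_le_one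
  · rintro ⟨i, k⟩ - ⟨i', k'⟩ - hne
    refine Set.disjoint_left.2 fun ω h h' => hne ?_
    have : some (i, k) = some (i', k') := Eq.trans (Eq.symm h) h'
    simp only [Option.some.injEq, Prod.mk.injEq] at this
    obtain ⟨rfl, rfl⟩ := this
    rfl
  · exact fun x _ => π.measurable_dec _ _

/-- The event that arrival `τ` is matched to unit `k` of `i`, which is still in use right after
arrival `t` has been served. -/
def inUse (t τ : Fin P.T) (i : I) (k : ℕ) : Set P.SamplePath :=
  {ω | π.dec τ ω = some (i, k) ∧ (τ < t → ENNReal.ofReal (P.a t - P.a τ) < ω τ i)}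

omit [Fintype I] in
theorem measurableSet_inUse (t τ : Fin P.T) (i : I) (k : ℕ) :
    MeasurableSet (π.inUse t τ i k) := by
  refine (π.measurable_dec τ _).inter ?_
  by_cases h : τ < t
  · simp only [h, forall_true_left]
    exact measurableSet_lt measurable_const
      ((measurable_pi_apply i).comp (measurable_pi_apply τ))
  · simp only [h, false_imp_iff]
    exact MeasurableSet.univ

theorem measureReal_inUse (t τ : Fin P.T) (i : I) (k : ℕ) :
    P.pathLaw.real (π.inUse t τ i k) = π.unitProb τ i k * (1 - P.returned i τ t) := by
  by_cases h : τ < t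
  · have hm : MeasurableSet (Set.Iic (ENNReal.ofReal (P.a t - P.a τ))) := measurableSet_Iic
    have h1 := π.integral_indicator_dec τ (some (i, k)) i
      (f := Set.indicator (Set.Iic (ENNReal.ofReal (P.a t - P.a τ)))ᶜ (fun _ => (1 : ℝ)))
      (measurable_const.indicator hm.compl)
    have h2 : ∫ d, Set.indicator (Set.Iic (ENNReal.ofReal (P.a t - P.a τ)))ᶜ
        (fun _ => (1 : ℝ)) d ∂P.law i = 1 - P.returned i τ t := by
      have h3 := integral_indicator_one (μ := P.law i) hm.compl
      rw [probReal_compl_eq_one_sub hm] at h3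
      rw [returned, if_pos (show (τ : ℕ) < t from h)]
      exact h3
    rw [h2] at h1
    refine Eq.trans ?_ h1
    rw [← integral_indicator_one (π.measurableSet_inUse t τ i k)]
    refine integral_congr_ae (Filter.Eventually.of_forall fun ω => ?_)
    by_cases h3 : π.dec τ ω = some (i, k) <;>
      by_cases h4 : ENNReal.ofReal (P.a t - P.a τ) < ω τ i <;>
      simp [inUse, Set.indicator, h3, h4, h]
  · have h1 : π.inUse t τ i k = {ω | π.dec τ ω = some (i, k)} := by
      simp [inUse, h]
    rw [h1, returned, if_neg (show ¬ (τ : ℕ) < t from h), sub_zero, mul_one]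
    rfl

omit [Fintype I] in
-- Being matched again at `τ'` requires a return by `a τ' ≤ a t`, whereas the first event says that
-- the unit is still out at `a t`. Disjointness then bounds the expected use of each unit by `1`.
theorem disjoint_inUse {t τ τ' : Fin P.T} (h : τ < τ') (h' : τ' ≤ t) (i : I) (k : ℕ) :
    Disjoint (π.inUse t τ i k) (π.inUse t τ' i k) := by
  refine Set.disjoint_left.2 fun ω hω hω' => ?_
  have h1 := π.available τ τ' ω i k h hω.1 hω'.1
  have h2 := hω.2 (h.trans_le h')
  have h3 : P.a τ' ≤ P.a t := P.a_le h' t.isLt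
  exact absurd (h1.trans (ENNReal.ofReal_le_ofReal (sub_le_sub_right h3 _))) (not_le.2 h2)

/-- In expectation, at most `c i` units of `i` are in use right after arrival `t`. -/
theorem sum_matchProb_mul_le (i : I) {t : ℕ} (ht : t < P.T) :
    ∑ τ ∈ Finset.range (t + 1), π.matchProb i τ * (1 - P.returned i τ t) ≤ P.cap i := by
  classical
  have hunit : ∀ k, ∑ τ ∈ Finset.Iic (⟨t, ht⟩ : Fin P.T),
      π.unitProb τ i k * (1 - P.returned i τ t) ≤ 1 := by
    intro k
    have h1 : ∀ τ : Fin P.T, π.unitProb τ i k * (1 - P.returned i τ t) =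
        P.pathLaw.real (π.inUse ⟨t, ht⟩ τ i k) := fun τ => (π.measureReal_inUse ⟨t, ht⟩ τ i k).symm
    simp only [h1]
    rw [← measureReal_biUnion_finset]
    · exact measureReal_le_one
    · intro τ hτ τ' hτ' hne
      simp only [Finset.coe_Iic, Set.mem_Iic] at hτ hτ'
      rcases lt_or_gt_of_ne hne with h | h
      · exact π.disjoint_inUse h hτ' i k
      · exact (π.disjoint_inUse h hτ i k).symm
    · exact fun τ _ => π.measurableSet_inUse _ τ i k
  calc ∑ τ ∈ Finset.range (t + 1), π.matchProb i τ * (1 - P.returned i τ t)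
      = ∑ τ ∈ Finset.Iic (⟨t, ht⟩ : Fin P.T),
          π.matchProb i τ * (1 - P.returned i τ t) := by
        symm
        refine Finset.sum_bij (fun τ _ => (τ : ℕ)) ?_ ?_ ?_ ?_
        · intro τ hτ
          have : τ ≤ ⟨t, ht⟩ := Finset.mem_Iic.1 hτ
          have : (τ : ℕ) ≤ t := this
          exact Finset.mem_range.2 (by omega)
        · exact fun τ _ τ' _ h => Fin.ext h
        · intro τ hτ
          have := Finset.mem_range.1 hτ
          exact ⟨⟨τ, by omega⟩, Finset.mem_Iic.2 (Nat.lt_succ_iff.1 this), rfl⟩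
        · exact fun _ _ => rfl
    _ = ∑ k ∈ Finset.Icc 1 (P.cap i), ∑ τ ∈ Finset.Iic (⟨t, ht⟩ : Fin P.T),
          π.unitProb τ i k * (1 - P.returned i τ t) := by
        rw [Finset.sum_comm]
        refine Finset.sum_congr rfl fun τ _ => ?_
        simp only [matchProb, τ.isLt, dif_pos, Finset.sum_mul]
    _ ≤ ∑ k ∈ Finset.Icc 1 (P.cap i), 1 := Finset.sum_le_sum fun k _ => hunit k
    _ = P.cap i := by simp

end OfflinePolicy

end

end RentalInstance

/-! ### Comparing the policy with the fluid algorithm. -/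

namespace RentalInstance

noncomputable section

variable {I : Type*} (P : RentalInstance I)

/-- The summand is `exp (-(j-1)/c) - exp (-j/c)`, so the sum telescopes. -/
theorem one_sub_exp_eq_sum (c : ℝ) (k : ℕ) : 1 - Real.exp (-((k : ℝ) / c)) =
    ∑ j ∈ Finset.Icc 1 k, Real.exp (-((j : ℝ) / c)) * (Real.exp (1 / c) - 1) := by
  induction k with
  | zero => simp
  | succ k ih =>
    rw [Finset.sum_Icc_succ_top (by omega), ← ih, mul_sub, ← Real.exp_add]
    have : -(((k + 1 : ℕ) : ℝ) / c) + 1 / c = -((k : ℝ) / c) := by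
      push_cast
      ring
    rw [this]
    ring

theorem mul_exp_one_div_sub_one_le {c : ℝ} (hc : 1 ≤ c) :
    c * (Real.exp (1 / c) - 1) ≤ 1 + 1 / c := by
  have hc0 : 0 < c := by linarith
  have h0 : (0 : ℝ) ≤ 1 / c := by positivity
  have h1 : |1 / c| ≤ 1 := by
    rw [abs_of_nonneg h0]
    exact (div_le_one hc0).2 hc
  have h2 := (abs_le.1 (Real.abs_exp_sub_one_sub_id_le h1)).2
  calc c * (Real.exp (1 / c) - 1) ≤ c * (1 / c + (1 / c) ^ 2) :=
        mul_le_mul_of_nonneg_left (by linarith) hc0.le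
    _ = 1 + 1 / c := by field_simp

variable [Fintype I]

theorem galg_eq (sel : ℕ → (I → ℕ) → I) : P.galg sel =
    ∑ i, P.meanRew i * ∑ k ∈ Finset.Icc 1 (P.cap i),
      ∑ t ∈ Finset.range P.T, (P.fluidState sel P.T).y t i k := by
  unfold galg fluidMatch
  exact Finset.sum_congr rfl fun i _ => by rw [Finset.sum_comm]

/-- The reduced prices paid by the fluid algorithm dominate the prices, after the fluid algorithm
has served each arrival, of the resources that the policy matches. -/
theorem sum_matchProb_mul_price_le {sel : ℕ → (I → ℕ) → I} (hsel : P.IsArgmaxRule sel)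
    (π : P.OfflinePolicy) :
    ∑ i, ∑ t ∈ Finset.range P.T,
        π.matchProb i t * P.price i (P.highest (P.fluidState sel (t + 1)).z i) ≤
      ∑ i, ∑ k ∈ Finset.Icc 1 (P.cap i), P.price i k *
        ∑ t ∈ Finset.range P.T, (P.fluidState sel P.T).y t i k := by
  have hy := (P.fluidState_nonneg hsel le_rfl).2
  have hR : ∑ i, ∑ k ∈ Finset.Icc 1 (P.cap i), P.price i k *
        ∑ t ∈ Finset.range P.T, (P.fluidState sel P.T).y t i k =
      ∑ t ∈ Finset.range P.T, ∑ i, ∑ k ∈ Finset.Icc 1 (P.cap i),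
        P.price i k * (P.fluidState sel P.T).y t i k := by
    simp only [Finset.mul_sum]
    rw [Finset.sum_comm]
    refine Finset.sum_congr rfl fun i _ => ?_
    rw [Finset.sum_comm]
  rw [hR, Finset.sum_comm]
  refine Finset.sum_le_sum fun t ht => ?_
  have hl : 0 ≤ ∑ i, ∑ k ∈ Finset.Icc 1 (P.cap i),
      P.price i k * (P.fluidState sel P.T).y t i k :=
    Finset.sum_nonneg fun i _ => Finset.sum_nonneg fun k _ =>
      mul_nonneg (P.price_nonneg i k) (hy t i k)
  -- The match probabilities of `t` sum to at most `1`, so a bound common to all neighbours bounds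
  -- the average. Non-neighbours have probability zero.
  refine le_trans (Finset.sum_le_sum fun i _ => ?_)
    ((Finset.sum_mul _ _ _).symm.le.trans (mul_le_of_le_one_left hl (π.sum_matchProb_le_one t)))
  by_cases h : π.matchProb i t = 0
  · simp [h]
  · exact mul_le_mul_of_nonneg_left (P.price_highest_fluidState_le hsel (Finset.mem_range.1 ht)
      (π.mem_nbr_of_matchProb_ne_zero h)) (π.matchProb_nonneg i t)

/-- Split `1 - 1/e` into one price increment per unit. Increments up to the highest available unit
make up the first sum; an increment above it is lost only at arrivals after which that unit is
exhausted, and there duality charges it to the fluid use of the unit. -/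
theorem le_sum_matchProb_mul {sel : ℕ → (I → ℕ) → I} (hsel : P.IsArgmaxRule sel)
    (π : P.OfflinePolicy) (i : I) :
    (1 - 1 / Real.exp 1) * ∑ t ∈ Finset.range P.T, π.matchProb i t ≤
      (∑ t ∈ Finset.range P.T, π.matchProb i t *
        (1 - Real.exp (-((P.highest (P.fluidState sel (t + 1)).z i : ℝ) / P.cap i)))) +
      ∑ k ∈ Finset.Icc 1 (P.cap i), Real.exp (-((k : ℝ) / P.cap i)) *
        (P.cap i * (Real.exp (1 / P.cap i) - 1)) *
        ∑ t ∈ Finset.range P.T, (P.fluidState sel P.T).y t i k := by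
  set c : ℝ := (P.cap i : ℝ) with hc
  have hcap : 0 < c := Nat.cast_pos.2 (P.cap_pos i)
  set δ : ℕ → ℝ := fun j => Real.exp (-((j : ℝ) / c)) * (Real.exp (1 / c) - 1) with hδ
  have hδ0 : ∀ j, 0 ≤ δ j := fun j => mul_nonneg (Real.exp_pos _).le
    (sub_nonneg.2 (Real.one_le_exp (by positivity)))
  have h1 : 1 - 1 / Real.exp 1 = ∑ j ∈ Finset.Icc 1 (P.cap i), δ j := by
    rw [← one_sub_exp_eq_sum, ← hc, div_self hcap.ne', Real.exp_neg, one_div]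
  have h2 : ∀ t, 1 - Real.exp (-((P.highest (P.fluidState sel (t + 1)).z i : ℝ) / c)) =
      ∑ j ∈ Finset.Icc 1 (P.cap i),
        if P.highest (P.fluidState sel (t + 1)).z i < j then 0 else δ j := by
    intro t
    rw [one_sub_exp_eq_sum, ← Finset.sum_subset (Finset.Icc_subset_Icc_right
      (P.highest_le_cap (P.fluidState sel (t + 1)).z i))]
    · refine Finset.sum_congr rfl fun j hj => ?_
      rw [if_neg (not_lt.2 (Finset.mem_Icc.1 hj).2)]
    · intro j hj hj'
      rw [Finset.mem_Icc] at hj hj'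
      rw [if_pos (by omega)]
  simp only [h2]
  rw [h1, Finset.sum_mul]
  simp only [Finset.mul_sum _ _ (π.matchProb i _)]
  rw [Finset.sum_comm (s := Finset.range P.T), ← Finset.sum_add_distrib]
  refine Finset.sum_le_sum fun j hj => ?_
  have h3 := P.sum_le_mul_sum_fluidState hsel i hj (π.matchProb i) (π.matchProb_nonneg i) c
    hcap.le fun t ht => π.sum_matchProb_mul_le i ht
  have h4 : ∑ t ∈ Finset.range P.T, π.matchProb i t *
      (if P.highest (P.fluidState sel (t + 1)).z i < j then 0 else δ j) =
      δ j * (∑ t ∈ Finset.range P.T, π.matchProb i t - ∑ t ∈ (Finset.range P.T).filter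
        (fun t => P.highest (P.fluidState sel (t + 1)).z i < j), π.matchProb i t) := by
    rw [Finset.sum_filter, ← Finset.sum_sub_distrib, Finset.mul_sum]
    refine Finset.sum_congr rfl fun t _ => ?_
    split_ifs <;> ring
  have h5 := mul_le_mul_of_nonneg_left h3 (hδ0 j)
  have h6 : Real.exp (-((j : ℝ) / c)) * (c * (Real.exp (1 / c) - 1)) = δ j * c := by
    simp only [hδ]
    ring
  rw [h4, h6]
  linarith

theorem mul_reward_le_mul_galg [Nonempty I] {sel : ℕ → (I → ℕ) → I} (hsel : P.IsArgmaxRule sel)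
    (π : P.OfflinePolicy) :
    (1 - 1 / Real.exp 1) * π.reward ≤ (1 + 1 / P.cmin) * P.galg sel := by
  have hy := (P.fluidState_nonneg hsel le_rfl).2
  have hcmin : ∀ i, P.cmin ≤ P.cap i := fun i => Finset.inf'_le _ (Finset.mem_univ i)
  have hcmin0 : 0 < P.cmin := (Finset.lt_inf'_iff _).2 fun i _ => P.cap_pos i
  set Y : I → ℕ → ℝ := fun i k => ∑ t ∈ Finset.range P.T, (P.fluidState sel P.T).y t i k with hY
  have hY0 : ∀ i k, 0 ≤ Y i k := fun i k => Finset.sum_nonneg fun t _ => hy t i k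
  have h1 : (1 - 1 / Real.exp 1) * π.reward ≤
      (∑ i, ∑ t ∈ Finset.range P.T,
        π.matchProb i t * P.price i (P.highest (P.fluidState sel (t + 1)).z i)) +
      ∑ i, P.meanRew i * ∑ k ∈ Finset.Icc 1 (P.cap i), Real.exp (-((k : ℝ) / P.cap i)) *
        (P.cap i * (Real.exp (1 / P.cap i) - 1)) * Y i k := by
    rw [π.reward_eq, Finset.mul_sum, ← Finset.sum_add_distrib]
    refine Finset.sum_le_sum fun i _ => ?_
    have h := mul_le_mul_of_nonneg_left (P.le_sum_matchProb_mul hsel π i) (P.meanRew_nonneg i)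
    rw [mul_add] at h
    refine le_trans (le_of_eq (by ring)) (h.trans (le_of_eq ?_))
    congr 1
    rw [Finset.mul_sum]
    refine Finset.sum_congr rfl fun t _ => ?_
    rw [price]
    ring
  refine h1.trans ((add_le_add_left (P.sum_matchProb_mul_price_le hsel π) _).trans ?_)
  rw [galg_eq, ← Finset.sum_add_distrib, Finset.mul_sum]
  refine Finset.sum_le_sum fun i _ => ?_
  rw [mul_left_comm, Finset.mul_sum (a := 1 + 1 / (P.cmin : ℝ)), Finset.mul_sum, Finset.mul_sum,
    ← Finset.sum_add_distrib]
  refine Finset.sum_le_sum fun k _ => ?_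
  have hc1 : (1 : ℝ) ≤ P.cap i := Nat.one_le_cast.2 (P.cap_pos i)
  have h2 := mul_exp_one_div_sub_one_le hc1
  have h3 : (1 : ℝ) / P.cap i ≤ 1 / P.cmin :=
    one_div_le_one_div_of_le (Nat.cast_pos.2 hcmin0) (Nat.cast_le.2 (hcmin i))
  have hE0 := Real.exp_pos (-((k : ℝ) / P.cap i))
  have hE1 : Real.exp (-((k : ℝ) / P.cap i)) ≤ 1 :=
    Real.exp_le_one_iff.2 (neg_nonpos.2 (by positivity))
  have h4 : (0 : ℝ) ≤ 1 / P.cmin := by positivity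
  have h5 : Real.exp (-((k : ℝ) / P.cap i)) * (P.cap i * (Real.exp (1 / P.cap i) - 1)) ≤
      Real.exp (-((k : ℝ) / P.cap i)) + 1 / P.cmin := by
    calc _ ≤ Real.exp (-((k : ℝ) / P.cap i)) * (1 + 1 / P.cmin) :=
          mul_le_mul_of_nonneg_left (h2.trans (by linarith)) hE0.le
      _ = Real.exp (-((k : ℝ) / P.cap i)) + Real.exp (-((k : ℝ) / P.cap i)) * (1 / P.cmin) := by
          ring
      _ ≤ _ := add_le_add_right (mul_le_of_le_one_left h4 hE1) _
  -- The total charge per use of unit `k`: its reduced price plus its share of the shortfall. The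
  -- exponentials cancel up to `1 / cmin`.
  have h6 : (1 - Real.exp (-((k : ℝ) / P.cap i))) + Real.exp (-((k : ℝ) / P.cap i)) *
      (P.cap i * (Real.exp (1 / P.cap i) - 1)) ≤ 1 + 1 / P.cmin := by linarith
  calc _ = P.meanRew i * (((1 - Real.exp (-((k : ℝ) / P.cap i))) +
        Real.exp (-((k : ℝ) / P.cap i)) * (P.cap i * (Real.exp (1 / P.cap i) - 1))) * Y i k) := by
        rw [price]
        ring
    _ ≤ _ := mul_le_mul_of_nonneg_left (mul_le_mul_of_nonneg_right h6 (hY0 i k))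
        (P.meanRew_nonneg i)

end

end RentalInstance

/-! ### The competitive ratio. -/

theorem mainTheorem2 :
    ∃ C : ℝ, 0 ≤ C ∧
      ∀ (I : Type*) [Fintype I] [Nonempty I] (P : RentalInstance I) (sel : ℕ → (I → ℕ) → I),
        P.IsArgmaxRule sel →
          P.galg sel ≥ (1 - 1 / Real.exp 1 - C / (P.cmin : ℝ)) * P.opt := by
  refine ⟨1, zero_le_one, fun I _ _ P sel hsel => ?_⟩
  have hβ : 0 < 1 - 1 / Real.exp 1 := by
    rw [sub_pos, div_lt_one (Real.exp_pos 1)]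
    exact Real.one_lt_exp_iff.2 one_pos
  have hopt : (1 - 1 / Real.exp 1) * P.opt ≤ (1 + 1 / P.cmin) * P.galg sel := by
    rw [mul_comm, ← le_div_iff₀ hβ]
    refine ciSup_le fun π => ?_
    rw [le_div_iff₀ hβ, mul_comm]
    exact P.mul_reward_le_mul_galg hsel π
  have hopt0 : 0 ≤ P.opt := Real.iSup_nonneg fun π =>
    integral_nonneg fun ω => Finset.sum_nonneg fun t _ => π.gain_nonneg t ω
  have hx : (0 : ℝ) ≤ 1 / P.cmin := by positivity
  set x : ℝ := 1 / P.cmin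
  set b : ℝ := 1 / Real.exp 1
  have hb : 0 ≤ b := by positivity
  -- With `C = 1`, `(1 + x) * (1 - b - x) = 1 - b - (b * x + x ^ 2) ≤ 1 - b`; since `OPT ≥ 0`, the
  -- bound `hopt` suffices.
  refine le_of_mul_le_mul_left (a := 1 + x) (le_trans ?_ hopt) (by linarith)
  have : 0 ≤ (b * x + x ^ 2) * P.opt := by positivity
  linarith
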